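/- There are universal constants $c>0$ and $k\in\mathbb N$ such that the following holds. Let $A_1,\dots,A_n$ be finite sets, at least two of which have at least two elements, let $N=\prod_{i=1}^n|A_i|$, and let $0<\sigma\le 1/4$. Consider any interactive proof system in which the verifier holds $s$ independent samples from an unknown distribution $D$ over $A_1\times\dots\times A_n$ together with private random coins, exchanges messages with a prover (over any finite number of rounds, with arbitrary message spaces, so with no bound on the communication or on the running time), and finally accepts or rejects. The prover sees only the verifier's messages and its own coins, and its strategy may depend on $D$. Suppose that: * **Completeness:** if $D$ is a product distribution (a product of distributions on the $A_i$) and the prover is honest, then the verifier accepts with probability at least $0.9$; * **Soundness:** if $D$ has total variation distance at least $\sigma$ from every product distribution, then, for any prover, the verifier accepts with probability at most $0.1$. Then $$s\;\ge\;\frac{c}{(\log N)^{k}}\cdot\frac{\sqrt N}{\sigma^{2}},\qquad\text{i.e.}\qquad s\ge\tilde\Omega\!\left(\frac{\sqrt N}{\sigma^2}\right).$$ -/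

import Mathlib

open MeasureTheory

namespace IndepProof

/-- The total variation distance of two probability distributions on a finite type. -/
noncomputable def tvDist {X : Type*} [Fintype X] (P Q : PMF X) : ℝ :=
  (1 / 2) * ∑ x, |(P x).toReal - (Q x).toReal|

/-- `D` is a product distribution over `A_1 × ⋯ × A_n`. -/
def IsProductDist {n : ℕ} {A : Fin n → Type*} (D : PMF (∀ i, A i)) : Prop :=
  ∃ m : ∀ i, PMF (A i), ∀ x, D x = ∏ i, m i (x i)

/-- `D` is at least `σ`-far, in total variation distance, from every product distribution. -/
def IsFarFromProduct {n : ℕ} {A : Fin n → Type*} [∀ i, Fintype (A i)]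
    (σ : ℝ) (D : PMF (∀ i, A i)) : Prop :=
  ∀ Q : PMF (∀ i, A i), IsProductDist Q → σ ≤ tvDist D Q

/-- A (possibly randomized) prover strategy against verifier messages in `M` with replies in `W`.
In round `i` it sees its own random coins and the verifier messages of the rounds `0, …, i`, and
its computational power is unrestricted. It may depend on the distribution under test in any way,
since strategies are always chosen after that distribution. -/
structure Prover (M W : Type) [MeasurableSpace M] [MeasurableSpace W] where
  Coins : Type
  [measurableSpaceCoins : MeasurableSpace Coins]
  coinLaw : Measure Coins
  [isProbabilityMeasure_coinLaw : IsProbabilityMeasure coinLaw]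
  reply : (i : ℕ) → Coins → (Fin (i + 1) → M) → W
  measurable_reply : ∀ i, Measurable fun p : Coins × (Fin (i + 1) → M) => reply i p.1 p.2

attribute [instance] Prover.measurableSpaceCoins Prover.isProbabilityMeasure_coinLaw

/-- An interactive proof system whose verifier holds `s` samples from a distribution on `X` and
private random coins. In round `i < rounds` the verifier sends a message computed from its samples,
its coins and the earlier replies of the prover, and the prover replies; after the last round the
verifier accepts or rejects. The samples and coins are not shown to the prover. The message
spaces, the number of rounds and the running time are unrestricted, so that there is no bound on
the communication. One-message (MA) systems are those with one round and a trivial verifier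
message; public-coin (AM) systems are those whose messages depend on the coins only.
`honest D` is the honest prover's strategy when the distribution under test is `D`. -/
structure ProofSystem (X : Type*) (s : ℕ) where
  VMsg : Type
  PMsg : Type
  [measurableSpaceVMsg : MeasurableSpace VMsg]
  [measurableSpacePMsg : MeasurableSpace PMsg]
  Coins : Type
  [measurableSpaceCoins : MeasurableSpace Coins]
  coinLaw : Measure Coins
  [isProbabilityMeasure_coinLaw : IsProbabilityMeasure coinLaw]
  rounds : ℕ
  message : (i : ℕ) → (Fin s → X) → Coins → (Fin i → PMsg) → VMsg
  measurable_message : ∀ i x,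
    Measurable fun p : Coins × (Fin i → PMsg) => message i x p.1 p.2
  accepts : (Fin s → X) → Coins → (Fin rounds → PMsg) → Prop
  measurableSet_accepts : ∀ x,
    MeasurableSet {p : Coins × (Fin rounds → PMsg) | accepts x p.1 p.2}
  honest : PMF X → Prover VMsg PMsg

attribute [instance] ProofSystem.measurableSpaceVMsg ProofSystem.measurableSpacePMsg
  ProofSystem.measurableSpaceCoins ProofSystem.isProbabilityMeasure_coinLaw

namespace ProofSystem

variable {X : Type*} {s : ℕ}

/-- The messages exchanged in the first `k` rounds between the verifier of `S`, holding the samples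
`x` and the coins `ω`, and the prover `P`, holding the coins `ρ`. -/
def transcript (S : ProofSystem X s) (P : Prover S.VMsg S.PMsg) (x : Fin s → X)
    (ω : S.Coins) (ρ : P.Coins) : (k : ℕ) → (Fin k → S.VMsg) × (Fin k → S.PMsg)
  | 0 => (Fin.elim0, Fin.elim0)
  | k + 1 =>
    let t := transcript S P x ω ρ k
    let sent : Fin (k + 1) → S.VMsg :=
      Fin.snoc (α := fun _ => S.VMsg) t.1 (S.message k x ω t.2)
    (sent, Fin.snoc (α := fun _ => S.PMsg) t.2 (P.reply k ρ sent))

/-- The probability that the verifier of `S` accepts when it interacts with the prover `P`, over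
`s` independent samples from `D` and the independent coins of both parties. -/
noncomputable def acceptProb [Fintype X] (S : ProofSystem X s) (P : Prover S.VMsg S.PMsg)
    (D : PMF X) : ℝ :=
  ∑ x : Fin s → X, (∏ j, (D (x j)).toReal) *
    (S.coinLaw.prod P.coinLaw).real
      {c | S.accepts x c.1 (S.transcript P x c.1 c.2 S.rounds).2}

end ProofSystem

/-- If `D` is a product distribution and the prover is honest, the verifier accepts with
probability at least `0.9`. -/
def Complete {n s : ℕ} {A : Fin n → Type*} [∀ i, Fintype (A i)]
    (S : ProofSystem (∀ i, A i) s) : Prop :=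
  ∀ D : PMF (∀ i, A i), IsProductDist D → 9 / 10 ≤ S.acceptProb (S.honest D) D

/-- If `D` is at least `σ`-far from every product distribution, the verifier accepts with
probability at most `0.1`, whatever the prover does. -/
def Sound {n s : ℕ} {A : Fin n → Type*} [∀ i, Fintype (A i)]
    (σ : ℝ) (S : ProofSystem (∀ i, A i) s) : Prop :=
  ∀ D : PMF (∀ i, A i), IsFarFromProduct σ D →
    ∀ P : Prover S.VMsg S.PMsg, S.acceptProb P D ≤ 1 / 10

end IndepProof

namespace IndepProof

/-! Soundness quantifies over all provers, so it also covers the honest prover of one fixed product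
distribution `D₀`. Fixing that prover makes the acceptance probability, given the samples, a `[0,
1]`-valued test that separates `D₀` from every far distribution. The interaction therefore gives no
advantage, and a lower bound for ordinary testing applies. The hard instances pair up values of two
nontrivial coordinates, which cuts the space into `K ≥ N / 9` blocks of size `2 × 2` plus leftover
points. `D₀` is uniform on the blocks; the alternatives tilt each block by `±ε` along its diagonal,
with arbitrary signs `θ`. A product distribution has rank one on each block, so every alternative is
far (`tvDist_map_blockPMF_ge`). Averaged over `θ`, the likelihood ratio has second moment at most
`exp (s² ε⁴ / (2K))`. By Cauchy–Schwarz no test separates unless `s² ε⁴` is of order `K`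
(`card_le_of_separates`). With `ε ≤ 4σ` this gives the bound without any logarithmic loss. -/

/-! ### Distance of a `2 × 2` matrix from rank one -/

/-- The `ℓ¹` distance of the matrix with diagonal `1 + ε` and off-diagonal `1 - ε` from the
singular matrices. -/
theorem l1_dist_singular_ge {ε a b c d : ℝ} (h0 : 0 ≤ ε) (h1 : ε ≤ 1) (h : a * d = b * c) :
    4 * ε / (1 + ε) ≤ |1 + ε - a| + |1 - ε - b| + |1 - ε - c| + |1 + ε - d| := by
  have hpos : 0 < 1 + ε := by linarith
  rw [div_le_iff₀ hpos]
  -- The determinant is `(1 + ε)² - (1 - ε)² = 4ε`. Perturbations of total size `δ < 4ε / (1 + ε)`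
  -- lower it by at most `(1 + ε) δ < 4ε`, so it cannot vanish.
  by_contra! hlt
  obtain ⟨p, hp⟩ : ∃ p, p = 1 + ε - a := ⟨_, rfl⟩
  obtain ⟨q, hq⟩ : ∃ q, q = 1 - ε - b := ⟨_, rfl⟩
  obtain ⟨r, hr⟩ : ∃ r, r = 1 - ε - c := ⟨_, rfl⟩
  obtain ⟨t, ht⟩ : ∃ t, t = 1 + ε - d := ⟨_, rfl⟩
  rw [← hp, ← hq, ← hr, ← ht] at hlt
  obtain rfl : a = 1 + ε - p := by linarith
  obtain rfl : b = 1 - ε - q := by linarith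
  obtain rfl : c = 1 - ε - r := by linarith
  obtain rfl : d = 1 + ε - t := by linarith
  have hsum : |p| + |q| + |r| + |t| ≤ 4 * ε := by
    nlinarith [abs_nonneg p, abs_nonneg q, abs_nonneg r, abs_nonneg t]
  -- This follows from `4ε ≤ (1 + ε)²`; it controls the product `p * t` when the signs of `p` and
  -- `t` differ.
  have hsum' : |p| + |q| + |r| + |t| ≤ 1 + ε := by
    by_contra! hc
    nlinarith [sq_nonneg (1 - ε)]
  have hdiag : (1 + ε) * (1 + ε) - (1 + ε) * (|p| + |t|) ≤ (1 + ε - p) * (1 + ε - t) := by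
    rcases abs_cases p with ⟨hp', _⟩ | ⟨hp', _⟩ <;> rcases abs_cases t with ⟨ht', _⟩ | ⟨ht', _⟩ <;>
      rw [hp', ht'] <;>
      nlinarith [abs_nonneg p, abs_nonneg q, abs_nonneg r, abs_nonneg t]
  have hoff : (1 - ε - q) * (1 - ε - r) ≤ (1 - ε) * (1 - ε) + (1 + ε) * (|q| + |r|) := by
    have h2 : q * r ≤ |q| * |r| := by rw [← abs_mul]; exact le_abs_self _
    have h3 : |q| * |r| ≤ 2 * ε * (|q| + |r|) := by
      have hq4 : |q| + |r| ≤ 4 * ε := by linarith [abs_nonneg p, abs_nonneg t]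
      nlinarith [sq_nonneg (|q| - |r|), abs_nonneg q, abs_nonneg r]
    nlinarith [neg_abs_le q, neg_abs_le r]
  nlinarith

/-! ### Sign patterns on blocks and the perturbed densities -/

/-- The sign of a bit. -/
def bitSign (b : Bool) : ℝ := if b then 1 else -1

section Blocks

variable {β : Type*}

/-- The sign pattern on the `2 × 2` blocks indexed by `β`, whose block `b` has diagonal sign
`θ b` and the opposite sign off the diagonal. -/
def blockSign (θ : β → Bool) (c : β × Bool × Bool) : ℝ :=
  bitSign (θ c.1) * (bitSign c.2.1 * bitSign c.2.2)

theorem abs_blockSign (θ : β → Bool) (c : β × Bool × Bool) : |blockSign θ c| = 1 := by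
  obtain ⟨b, s, t⟩ := c
  unfold blockSign bitSign
  cases s <;> cases t <;> cases θ b <;> simp

variable [Fintype β]

theorem sum_blockSign (θ : β → Bool) : ∑ c, blockSign θ c = 0 := by
  simp [Fintype.sum_prod_type, blockSign, bitSign]

theorem sum_blockSign_mul (θ η : β → Bool) :
    ∑ c, blockSign θ c * blockSign η c = 4 * ∑ b, bitSign (θ b) * bitSign (η b) := by
  simp only [Fintype.sum_prod_type, Fintype.sum_bool, blockSign, bitSign, Finset.mul_sum]
  refine Finset.sum_congr rfl fun b _ => ?_
  simp only [if_true, if_false, Bool.false_eq_true]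
  ring

/-- The density of the uniform distribution on the cells, perturbed by `ε` times a sign pattern. -/
noncomputable def blockDensity (ε : ℝ) (θ : β → Bool) (c : β × Bool × Bool) : ℝ :=
  (1 + ε * blockSign θ c) / (4 * Fintype.card β)

theorem blockDensity_nonneg {ε : ℝ} (h0 : 0 ≤ ε) (h1 : ε ≤ 1) (θ : β → Bool)
    (c : β × Bool × Bool) : 0 ≤ blockDensity ε θ c := by
  have h := neg_abs_le (blockSign θ c)
  rw [abs_blockSign] at h
  unfold blockDensity
  apply div_nonneg _ (by positivity)
  nlinarith

theorem card_cells : (∑ _c : β × Bool × Bool, (1 : ℝ)) = 4 * Fintype.card β := by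
  simp [Fintype.card_prod]; ring

theorem sum_blockDensity [Nonempty β] (ε : ℝ) (θ : β → Bool) : ∑ c, blockDensity ε θ c = 1 := by
  have hK : (4 * (Fintype.card β : ℝ)) ≠ 0 := by positivity
  simp only [blockDensity, ← Finset.sum_div, Finset.sum_add_distrib, ← Finset.mul_sum,
    sum_blockSign, card_cells]
  field_simp
  ring

theorem blockDensity_zero (θ : β → Bool) (c : β × Bool × Bool) :
    blockDensity 0 θ c = 1 / (4 * Fintype.card β) := by
  simp [blockDensity]

/-! ### Second moment of the likelihood ratio -/

/-- The likelihood ratio of `s` samples under `blockDensity ε θ` to the uniform distribution. -/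
noncomputable def likelihood {s : ℕ} (ε : ℝ) (θ : β → Bool) (x : Fin s → β × Bool × Bool) : ℝ :=
  ∏ j, (1 + ε * blockSign θ (x j))

theorem prod_blockDensity {s : ℕ} (ε : ℝ) (θ : β → Bool) (x : Fin s → β × Bool × Bool) :
    ∏ j, blockDensity ε θ (x j) = (1 / (4 * Fintype.card β)) ^ s * likelihood ε θ x := by
  simp only [blockDensity, likelihood, div_eq_mul_inv, Finset.prod_mul_distrib, one_mul,
    Finset.prod_const, Finset.card_univ, Fintype.card_fin]
  ring

theorem sum_likelihood [Nonempty β] (s : ℕ) (ε : ℝ) (θ : β → Bool) :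
    ∑ x : Fin s → β × Bool × Bool, (1 / (4 * (Fintype.card β : ℝ))) ^ s * likelihood ε θ x
      = 1 := by
  simp only [← prod_blockDensity]
  rw [← Fintype.sum_pow, sum_blockDensity, one_pow]

/-- Independence of the samples turns the sum into the `s`-th power of a one-sample expectation, in
which the terms linear in `ε` cancel. -/
theorem sum_likelihood_mul [Nonempty β] (s : ℕ) (ε : ℝ) (θ η : β → Bool) :
    ∑ x : Fin s → β × Bool × Bool,
        (1 / (4 * (Fintype.card β : ℝ))) ^ s * (likelihood ε θ x * likelihood ε η x)
      = (1 + ε ^ 2 / Fintype.card β * ∑ b, bitSign (θ b) * bitSign (η b)) ^ s := by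
  have hK : (Fintype.card β : ℝ) ≠ 0 := by positivity
  have hcell : ∑ c : β × Bool × Bool, 1 / (4 * (Fintype.card β : ℝ)) *
      ((1 + ε * blockSign θ c) * (1 + ε * blockSign η c))
      = 1 + ε ^ 2 / Fintype.card β * ∑ b, bitSign (θ b) * bitSign (η b) := by
    have hexp : ∀ c : β × Bool × Bool, (1 + ε * blockSign θ c) * (1 + ε * blockSign η c)
        = 1 + ε * blockSign θ c + ε * blockSign η c
          + ε ^ 2 * (blockSign θ c * blockSign η c) := fun c => by ring
    simp only [hexp, ← Finset.mul_sum, Finset.sum_add_distrib, sum_blockSign, sum_blockSign_mul,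
      card_cells]
    field_simp
    ring
  rw [← hcell, Fintype.sum_pow]
  refine Finset.sum_congr rfl fun x _ => ?_
  simp [likelihood, Finset.prod_mul_distrib]

/-- For fixed `η` and uniform `θ` the products of signs are independent uniform signs, so the sum
factors into copies of `2 * cosh t`, and `cosh t ≤ exp (t² / 2)`. -/
theorem sum_exp_correlation_le [DecidableEq β] (t : ℝ) (η : β → Bool) :
    ∑ θ : β → Bool, Real.exp (t * ∑ b, bitSign (θ b) * bitSign (η b))
      ≤ 2 ^ Fintype.card β * Real.exp (Fintype.card β * (t ^ 2 / 2)) := by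
  have h : ∑ θ : β → Bool, Real.exp (t * ∑ b, bitSign (θ b) * bitSign (η b))
      = ∏ _b : β, (2 * Real.cosh t) := by
    have hb : ∀ b, 2 * Real.cosh t = ∑ σ : Bool, Real.exp (t * (bitSign σ * bitSign (η b))) := by
      intro b
      rw [Real.cosh_eq]
      cases η b <;> simp [bitSign] <;> ring
    rw [Finset.prod_congr rfl fun b _ => hb b, Fintype.prod_sum]
    refine Finset.sum_congr rfl fun θ _ => ?_
    rw [Finset.mul_sum, Real.exp_sum]
  rw [h, Finset.prod_const, Finset.card_univ, mul_pow, Real.exp_nat_mul]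
  gcongr
  exact Real.cosh_le_exp_half_sq t

/-- The second moment of the average likelihood ratio over all sign patterns. -/
theorem sum_sum_likelihood_mul_le [Nonempty β] [DecidableEq β] (s : ℕ) {ε : ℝ} (h0 : 0 ≤ ε)
    (h1 : ε ≤ 1) (η : β → Bool) :
    ∑ θ : β → Bool, ∑ x : Fin s → β × Bool × Bool,
        (1 / (4 * (Fintype.card β : ℝ))) ^ s * (likelihood ε θ x * likelihood ε η x)
      ≤ 2 ^ Fintype.card β * Real.exp (s ^ 2 * ε ^ 4 / (2 * Fintype.card β)) := by
  have hK : (0 : ℝ) < Fintype.card β := by positivity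
  have hle := sum_exp_correlation_le (s * (ε ^ 2 / Fintype.card β)) η
  have hexp : Fintype.card β * ((s * (ε ^ 2 / Fintype.card β)) ^ 2 / 2)
      = s ^ 2 * ε ^ 4 / (2 * (Fintype.card β : ℝ)) := by field_simp
  rw [hexp] at hle
  refine le_trans (Finset.sum_le_sum fun θ _ => ?_) hle
  rw [sum_likelihood_mul, mul_assoc, Real.exp_nat_mul]
  set r := ∑ b, bitSign (θ b) * bitSign (η b) with hr
  have habs : -(Fintype.card β : ℝ) ≤ r := by
    have : ∑ _b : β, (-1 : ℝ) ≤ r := Finset.sum_le_sum fun b _ => by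
      cases θ b <;> cases η b <;> simp [bitSign]
    simpa using this
  -- Raising `1 + x ≤ exp x` to the power `s` needs a nonnegative base; here it is at least `1 -
  -- ε²`.
  have hnn : 0 ≤ 1 + ε ^ 2 / Fintype.card β * r := by
    have h2 : ε ^ 2 / Fintype.card β * -(Fintype.card β : ℝ) ≤ ε ^ 2 / Fintype.card β * r := by
      gcongr
    have h3 : ε ^ 2 / Fintype.card β * -(Fintype.card β : ℝ) = - ε ^ 2 := by field_simp
    nlinarith
  apply pow_le_pow_left₀ hnn
  rw [add_comm]
  exact Real.add_one_le_exp _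

/-- A test with values in `[0, 1]` that separates the uniform distribution on the cells from all of
its perturbations needs many samples. -/
theorem card_le_of_separates [Nonempty β] {s : ℕ} {ε : ℝ} (h0 : 0 ≤ ε) (h1 : ε ≤ 1)
    (g : (Fin s → β × Bool × Bool) → ℝ) (hg0 : ∀ x, 0 ≤ g x) (hg1 : ∀ x, g x ≤ 1)
    (hnull : ∀ θ : β → Bool, 9 / 10 ≤ ∑ x, (∏ j, blockDensity 0 θ (x j)) * g x)
    (hfar : ∀ θ : β → Bool, ∑ x, (∏ j, blockDensity ε θ (x j)) * g x ≤ 1 / 10) :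
    4 / 5 * (Fintype.card β : ℝ) ≤ s ^ 2 * ε ^ 4 := by
  classical
  have hK : (0 : ℝ) < Fintype.card β := by positivity
  set u : ℝ := (1 / (4 * (Fintype.card β : ℝ))) ^ s with hu
  have hu0 : 0 ≤ u := by positivity
  set T : ℝ := 2 ^ Fintype.card β with hT
  have hTpos : 0 < T := by positivity
  have hTcard : ∑ _θ : β → Bool, (1 : ℝ) = T := by simp [hT]
  set F : (Fin s → β × Bool × Bool) → ℝ := fun x => (∑ θ : β → Bool, likelihood ε θ x) / T with hF
  have hu1 : ∑ _x : Fin s → β × Bool × Bool, u = 1 := by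
    have := sum_likelihood (β := β) s 0 (fun _ => true)
    simpa only [likelihood, zero_mul, add_zero, Finset.prod_const_one, mul_one, ← hu] using this
  have hF1 : ∑ x, u * F x = 1 := by
    have : ∑ x, u * F x =
        (∑ θ : β → Bool, ∑ x : Fin s → β × Bool × Bool, u * likelihood ε θ x) / T := by
      rw [Finset.sum_comm, Finset.sum_div]
      simp only [hF, ← Finset.mul_sum, mul_div_assoc]
    rw [this]
    simp only [hu, sum_likelihood, hTcard]
    exact div_self hTpos.ne'
  have hFg : ∑ x, u * F x * g x ≤ 1 / 10 := by
    have : ∑ x, u * F x * g x =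
        (∑ θ : β → Bool, ∑ x : Fin s → β × Bool × Bool, u * likelihood ε θ x * g x) / T := by
      rw [Finset.sum_comm, Finset.sum_div]
      simp only [hF, ← Finset.mul_sum, ← Finset.sum_mul]
      exact Finset.sum_congr rfl fun x _ => by ring
    rw [this, div_le_iff₀ hTpos, ← hTcard, Finset.mul_sum]
    refine Finset.sum_le_sum fun θ _ => ?_
    simpa only [prod_blockDensity, mul_one] using hfar θ
  have hg : 9 / 10 ≤ ∑ x, u * g x := by
    simpa only [prod_blockDensity, likelihood, zero_mul, add_zero, Finset.prod_const_one, mul_one,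
      ← hu] using hnull fun _ => true
  have hFF : ∑ x, u * F x ^ 2 ≤ Real.exp (s ^ 2 * ε ^ 4 / (2 * Fintype.card β)) := by
    have : ∑ x, u * F x ^ 2 = (∑ η : β → Bool, ∑ θ : β → Bool, ∑ x : Fin s → β × Bool × Bool,
        u * (likelihood ε θ x * likelihood ε η x)) / T ^ 2 := by
      have hsq : ∀ x, u * F x ^ 2 = (∑ η : β → Bool, ∑ θ : β → Bool,
          u * (likelihood ε θ x * likelihood ε η x)) / T ^ 2 := by
        intro x
        simp only [hF, ← Finset.mul_sum, ← Finset.sum_mul]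
        ring
      simp only [hsq, ← Finset.sum_div]
      rw [Finset.sum_comm]
      congr 1
      exact Finset.sum_congr rfl fun η _ => Finset.sum_comm
    rw [this, div_le_iff₀ (by positivity)]
    calc _ ≤ ∑ _η : β → Bool, T * Real.exp (s ^ 2 * ε ^ 4 / (2 * Fintype.card β)) :=
          Finset.sum_le_sum fun η _ => sum_sum_likelihood_mul_le s h0 h1 η
      _ = _ := by
          rw [← mul_one (T * _), ← Finset.mul_sum, hTcard]; ring
  have hgap : 8 / 10 ≤ ∑ x, u * (g x * (1 - F x)) := by
    have : ∑ x, u * (g x * (1 - F x)) = ∑ x, u * g x - ∑ x, u * F x * g x := by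
      rw [← Finset.sum_sub_distrib]
      exact Finset.sum_congr rfl fun x _ => by ring
    linarith
  -- Cauchy–Schwarz under the uniform weight `u`: the gap `8 / 10` forces the variance of `F` to be
  -- at least `0.64`.
  have hcs : (∑ x, u * (g x * (1 - F x))) ^ 2
      ≤ (∑ x, u * g x ^ 2) * ∑ x, u * (1 - F x) ^ 2 :=
    Finset.sum_sq_le_sum_mul_sum_of_sq_le_mul _ (fun x _ => by positivity)
      (fun x _ => by positivity) fun x _ => by apply le_of_eq; ring
  have hgg : ∑ x, u * g x ^ 2 ≤ 1 := by
    rw [← hu1]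
    refine Finset.sum_le_sum fun x _ => ?_
    have : g x ^ 2 ≤ 1 := pow_le_one₀ (hg0 x) (hg1 x)
    nlinarith
  have hvar : ∑ x, u * (1 - F x) ^ 2 = ∑ x, u * F x ^ 2 - 1 := by
    have : ∑ x, u * (1 - F x) ^ 2
        = ∑ _x : Fin s → β × Bool × Bool, u - 2 * ∑ x, u * F x + ∑ x, u * F x ^ 2 := by
      rw [Finset.mul_sum, ← Finset.sum_sub_distrib, ← Finset.sum_add_distrib]
      exact Finset.sum_congr rfl fun x _ => by ring
    rw [this, hu1, hF1]; ring
  have hvar0 : 0 ≤ ∑ x, u * (1 - F x) ^ 2 := Finset.sum_nonneg fun x _ => by positivity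
  have hexp : 164 / 100 ≤ Real.exp (s ^ 2 * ε ^ 4 / (2 * Fintype.card β)) := by
    nlinarith
  by_contra! hlt
  set y : ℝ := s ^ 2 * ε ^ 4 / (2 * Fintype.card β) with hy
  have hy0 : 0 ≤ y := by positivity
  have hy1 : y < 2 / 5 := by rw [hy, div_lt_iff₀ (by positivity)]; linarith
  -- For `y < 2 / 5` this gives `exp y ≤ 1 + y + y² < 1.56`, below the required `1.64`.
  have hbound := Real.abs_exp_sub_one_sub_id_le (x := y) (by rw [abs_of_nonneg hy0]; linarith)
  have := (abs_le.1 hbound).2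
  nlinarith

/-! ### Transport to the product space and reduction to testing -/

theorem map_apply_of_injective {C X : Type*} (p : PMF C) {e : C → X} (he : e.Injective) (c : C) :
    p.map e (e c) = p c := by
  rw [PMF.map_apply, tsum_eq_single c fun c' hc' => if_neg fun h => hc' (he h).symm, if_pos rfl]

theorem map_apply_of_notMem_range {C X : Type*} (p : PMF C) {e : C → X} {x : X}
    (hx : x ∉ Set.range e) : p.map e x = 0 := by
  rw [PMF.map_apply, ENNReal.tsum_eq_zero]
  exact fun c => if_neg fun h => hx ⟨c, h.symm⟩

theorem acceptProb_map {C X : Type*} [Fintype C] [Fintype X] {s : ℕ} (S : ProofSystem X s)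
    (P : Prover S.VMsg S.PMsg) (p : PMF C) {e : C → X} (he : e.Injective) :
    S.acceptProb P (p.map e) = ∑ x : Fin s → C, (∏ j, (p (x j)).toReal) *
      (S.coinLaw.prod P.coinLaw).real
        {c | S.accepts (e ∘ x) c.1 (S.transcript P (e ∘ x) c.1 c.2 S.rounds).2} := by
  symm
  refine Finset.sum_of_injOn (fun x => e ∘ x) (he.comp_left.injOn) (by simp) ?_ ?_
  · intro y _ hy
    have : ∃ j, y j ∉ Set.range e := by
      by_contra! h
      choose x hx using h
      exact hy ⟨x, by simp, funext hx⟩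
    obtain ⟨j, hj⟩ := this
    rw [Finset.prod_eq_zero (Finset.mem_univ j) (by rw [map_apply_of_notMem_range p hj]; rfl),
      zero_mul]
  · intro x _
    simp only [Function.comp_apply, map_apply_of_injective p he]

variable [Nonempty β]

/-- The distribution on the cells with density `blockDensity ε θ`. -/
noncomputable def blockPMF {ε : ℝ} (h0 : 0 ≤ ε) (h1 : ε ≤ 1) (θ : β → Bool) :
    PMF (β × Bool × Bool) :=
  PMF.ofFintype (fun c => ENNReal.ofReal (blockDensity ε θ c)) <| by
    rw [← ENNReal.ofReal_sum_of_nonneg fun c _ => blockDensity_nonneg h0 h1 θ c,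
      sum_blockDensity, ENNReal.ofReal_one]

theorem blockPMF_toReal {ε : ℝ} (h0 : 0 ≤ ε) (h1 : ε ≤ 1) (θ : β → Bool)
    (c : β × Bool × Bool) : (blockPMF h0 h1 θ c).toReal = blockDensity ε θ c := by
  rw [blockPMF, PMF.ofFintype_apply, ENNReal.toReal_ofReal (blockDensity_nonneg h0 h1 θ c)]

/-- A block distribution is far from every distribution that has rank one on each block. -/
theorem tvDist_map_blockPMF_ge {X : Type*} [Fintype X] {ε : ℝ} (h0 : 0 ≤ ε) (h1 : ε ≤ 1)
    (θ : β → Bool) {e : β × Bool × Bool → X} (he : e.Injective) (Q : PMF X)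
    (hQ : ∀ b, Q (e (b, true, true)) * Q (e (b, false, false))
      = Q (e (b, true, false)) * Q (e (b, false, true))) :
    ε / (2 * (1 + ε)) ≤ tvDist ((blockPMF h0 h1 θ).map e) Q := by
  have hK : (0 : ℝ) < Fintype.card β := by positivity
  set q : β × Bool × Bool → ℝ := fun c => 4 * Fintype.card β * (Q (e c)).toReal with hq
  -- Mass of `Q` outside the image of `e` can only increase the distance, so it is dropped.
  have hsub : ∑ c, |blockDensity ε θ c - (Q (e c)).toReal|
      ≤ ∑ x, |((blockPMF h0 h1 θ).map e x).toReal - (Q x).toReal| := by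
    rw [Finset.sum_congr rfl fun c _ => by
      rw [← blockPMF_toReal h0 h1, ← map_apply_of_injective (blockPMF h0 h1 θ) he c]]
    refine le_of_eq_of_le (Finset.sum_map Finset.univ ⟨e, he⟩
      fun x => |((blockPMF h0 h1 θ).map e x).toReal - (Q x).toReal|).symm ?_
    exact Finset.sum_le_sum_of_subset_of_nonneg (Finset.subset_univ _) fun _ _ _ => abs_nonneg _
  have hcell : ∀ c, |blockDensity ε θ c - (Q (e c)).toReal|
      = |1 + ε * blockSign θ c - q c| / (4 * Fintype.card β) := by
    intro c
    rw [← abs_of_pos (by positivity : (0 : ℝ) < 4 * Fintype.card β), ← abs_div, blockDensity, hq]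
    congr 1
    field_simp
  have hblock : ∀ b, 4 * ε / (1 + ε) / (4 * Fintype.card β)
      ≤ ∑ st, |blockDensity ε θ (b, st) - (Q (e (b, st))).toReal| := by
    intro b
    have hQb : q (b, true, true) * q (b, false, false)
        = q (b, true, false) * q (b, false, true) := by
      have := congrArg ENNReal.toReal (hQ b)
      rw [ENNReal.toReal_mul, ENNReal.toReal_mul] at this
      simp only [hq]
      linear_combination (4 * (Fintype.card β : ℝ)) ^ 2 * this
    simp only [hcell, ← Finset.sum_div]
    gcongr
    simp only [Fintype.sum_prod_type, Fintype.sum_bool, blockSign, bitSign]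
    -- For the sign `false` the large entries lie off the diagonal, so the rank-one identity is used
    -- with its sides exchanged.
    cases θ b
    · have := l1_dist_singular_ge h0 h1 hQb.symm
      simp at this ⊢
      simp only [← sub_eq_add_neg]
      linarith
    · have := l1_dist_singular_ge h0 h1 hQb
      simp at this ⊢
      simp only [← sub_eq_add_neg]
      linarith
  have hsum : ε / (1 + ε) ≤ ∑ c, |blockDensity ε θ c - (Q (e c)).toReal| := by
    rw [Fintype.sum_prod_type]
    refine le_trans (le_of_eq ?_) (Finset.sum_le_sum fun b _ => hblock b)
    rw [Finset.sum_const, Finset.card_univ, nsmul_eq_mul]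
    field_simp
  unfold tvDist
  have : ε / (2 * (1 + ε)) = 1 / 2 * (ε / (1 + ε)) := by
    field_simp
  rw [this]
  linarith

/-- The sample bound for any space with an embedded grid of `2 × 2` blocks on which product
distributions have rank one and whose uniform distribution is a product. -/
theorem card_blocks_le {n s : ℕ} {A : Fin n → Type*} [∀ i, Fintype (A i)]
    {e : β × Bool × Bool → ∀ i, A i} (he : e.Injective)
    (hrank : ∀ Q : PMF (∀ i, A i), IsProductDist Q → ∀ b,
      Q (e (b, true, true)) * Q (e (b, false, false))
        = Q (e (b, true, false)) * Q (e (b, false, true)))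
    (hunif : ∀ D : PMF (β × Bool × Bool), (∀ c, D c = (4 * (Fintype.card β : ENNReal))⁻¹) →
      IsProductDist (D.map e))
    {σ : ℝ} (hσ0 : 0 < σ) (hσ1 : σ ≤ 1 / 4) (S : ProofSystem (∀ i, A i) s)
    (hc : Complete S) (hs : Sound σ S) :
    4 / 5 * (Fintype.card β : ℝ) ≤ s ^ 2 * (4 * σ) ^ 4 := by
  -- This solves `ε / (2 * (1 + ε)) = σ`; the assumption `σ ≤ 1 / 4` is what gives `ε ≤ 1` and `ε ≤
  -- 4σ`.
  set ε : ℝ := 2 * σ / (1 - 2 * σ) with hε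
  have hden : 0 < 1 - 2 * σ := by linarith
  have h0 : 0 ≤ ε := by positivity
  have h1 : ε ≤ 1 := by rw [hε, div_le_one hden]; linarith
  have h4 : ε ≤ 4 * σ := by rw [hε, div_le_iff₀ hden]; nlinarith
  have hεσ : ε / (2 * (1 + ε)) = σ := by
    have : 1 + ε = 1 / (1 - 2 * σ) := by rw [hε]; field_simp; ring
    rw [this, hε]
    field_simp
  set D₀ : PMF (β × Bool × Bool) := blockPMF le_rfl zero_le_one fun _ => true with hD₀
  have hprod : IsProductDist (D₀.map e) := by
    refine hunif D₀ fun c => ?_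
    rw [hD₀, blockPMF, PMF.ofFintype_apply, blockDensity_zero, one_div,
      ENNReal.ofReal_inv_of_pos (by positivity), ENNReal.ofReal_mul (by norm_num)]
    simp
  -- This single prover is also the cheating prover against every `θ`.
  set P := S.honest (D₀.map e) with hP
  refine le_trans (card_le_of_separates h0 h1 (fun x => (S.coinLaw.prod P.coinLaw).real
    {c | S.accepts (e ∘ x) c.1 (S.transcript P (e ∘ x) c.1 c.2 S.rounds).2})
    (fun x => measureReal_nonneg) (fun x => measureReal_le_one) ?_ ?_) (by gcongr)
  · intro θ
    have := hc _ hprod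
    rw [acceptProb_map S _ D₀ he] at this
    simpa only [hD₀, blockPMF_toReal, blockDensity_zero] using this
  · intro θ
    have := hs ((blockPMF h0 h1 θ).map e)
      (fun Q hQ => hεσ ▸ tvDist_map_blockPMF_ge h0 h1 θ he Q (hrank Q hQ)) P
    rw [acceptProb_map S _ _ he] at this
    simpa only [blockPMF_toReal] using this

end Blocks

/-! ### Embedding the block grid in the product space -/

section Grid

variable {n : ℕ} {A : Fin n → Type*} {i j : Fin n}

/-- The coordinates other than `i` and `j`. -/
abbrev OtherIndex (hij : j ≠ i) : Type :=
  {k : {k : Fin n // k ≠ i} // k ≠ ⟨j, hij⟩}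

/-- Splitting off the coordinates `i` and `j`. -/
def splitPair (A : Fin n → Type*) (hij : j ≠ i) :
    (∀ k, A k) ≃ A i × A j × (∀ k : OtherIndex hij, A k.1.1) :=
  (Equiv.piSplitAt i A).trans
    (Equiv.prodCongr (Equiv.refl _)
      (Equiv.piSplitAt (⟨j, hij⟩ : {k : Fin n // k ≠ i}) fun k => A k.1))

theorem splitPair_apply (hij : j ≠ i) (x : ∀ k, A k) :
    splitPair A hij x = (x i, x j, fun k : OtherIndex hij => x k.1.1) := rfl

theorem splitPair_symm_apply_left (hij : j ≠ i) (z) : (splitPair A hij).symm z i = z.1 :=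
  congrArg Prod.fst ((splitPair A hij).apply_symm_apply z)

theorem splitPair_symm_apply_right (hij : j ≠ i) (z) : (splitPair A hij).symm z j = z.2.1 :=
  congrArg (fun y => y.2.1) ((splitPair A hij).apply_symm_apply z)

theorem splitPair_symm_apply_other (hij : j ≠ i) (z) (k : OtherIndex hij) :
    (splitPair A hij).symm z k.1.1 = z.2.2 k :=
  congrFun (congrArg (fun y => y.2.2) ((splitPair A hij).apply_symm_apply z)) k

theorem prod_splitPair {R : Type*} [CommMonoid R] (hij : j ≠ i) (f : Fin n → R) :
    ∏ k, f k = f i * (f j * ∏ k : OtherIndex hij, f k.1.1) := by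
  rw [Fintype.prod_eq_mul_prod_subtype_ne f i,
    Fintype.prod_eq_mul_prod_subtype_ne (fun k : {k : Fin n // k ≠ i} => f k.1) ⟨j, hij⟩]

/-- The points of the product space obtained by pairing up values of the coordinates `i` and `j`. -/
def gridPoint (hij : j ≠ i) {M L : ℕ} (u : Fin M × Bool ↪ A i) (v : Fin L × Bool ↪ A j)
    (c : (Fin M × Fin L × (∀ k : OtherIndex hij, A k.1.1)) × Bool × Bool) : ∀ k, A k :=
  (splitPair A hij).symm (u (c.1.1, c.2.1), v (c.1.2.1, c.2.2), c.1.2.2)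

theorem gridPoint_injective (hij : j ≠ i) {M L : ℕ} (u : Fin M × Bool ↪ A i)
    (v : Fin L × Bool ↪ A j) : Function.Injective (gridPoint hij u v) := by
  rintro ⟨⟨a, b, r⟩, s, t⟩ ⟨⟨a', b', r'⟩, s', t'⟩ h
  have h' := (splitPair A hij).symm.injective h
  simp only [Prod.mk.injEq, u.injective.eq_iff, v.injective.eq_iff] at h'
  obtain ⟨⟨rfl, rfl⟩, ⟨rfl, rfl⟩, rfl⟩ := h'
  rfl

theorem mem_range_gridPoint (hij : j ≠ i) {M L : ℕ} (u : Fin M × Bool ↪ A i)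
    (v : Fin L × Bool ↪ A j) {x : ∀ k, A k} (hu : x i ∈ Set.range u) (hv : x j ∈ Set.range v) :
    x ∈ Set.range (gridPoint hij u v) := by
  obtain ⟨⟨a, s⟩, ha⟩ := hu
  obtain ⟨⟨b, t⟩, hb⟩ := hv
  refine ⟨((a, b, fun k => x k.1.1), s, t), ?_⟩
  rw [gridPoint, Equiv.symm_apply_eq, splitPair_apply]
  simp only [ha, hb]

theorem IsProductDist.gridPoint_rank_one (hij : j ≠ i) {M L : ℕ} (u : Fin M × Bool ↪ A i)
    (v : Fin L × Bool ↪ A j) {Q : PMF (∀ k, A k)} (hQ : IsProductDist Q)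
    (b : Fin M × Fin L × (∀ k : OtherIndex hij, A k.1.1)) :
    Q (gridPoint hij u v (b, true, true)) * Q (gridPoint hij u v (b, false, false))
      = Q (gridPoint hij u v (b, true, false)) * Q (gridPoint hij u v (b, false, true)) := by
  obtain ⟨m, hm⟩ := hQ
  simp only [hm, prod_splitPair hij, gridPoint, splitPair_symm_apply_left,
    splitPair_symm_apply_right, splitPair_symm_apply_other]
  ring

variable [∀ k, Fintype (A k)] [∀ k, Nonempty (A k)]

theorem isProductDist_map_gridPoint (hij : j ≠ i) {M L : ℕ} [NeZero M] [NeZero L]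
    (u : Fin M × Bool ↪ A i) (v : Fin L × Bool ↪ A j)
    (D : PMF ((Fin M × Fin L × (∀ k : OtherIndex hij, A k.1.1)) × Bool × Bool))
    (hD : ∀ c, D c = (4 * (Fintype.card (Fin M × Fin L × (∀ k : OtherIndex hij, A k.1.1)) :
      ENNReal))⁻¹) :
    IsProductDist (D.map (gridPoint hij u v)) := by
  -- The marginals are uniform on the paired values in coordinates `i` and `j`, and uniform on the
  -- whole of every other factor.
  refine ⟨Function.update (Function.update (fun k => PMF.uniformOfFintype (A k)) i
    ((PMF.uniformOfFintype (Fin M × Bool)).map u)) j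
    ((PMF.uniformOfFintype (Fin L × Bool)).map v), fun x => ?_⟩
  have hother : ∀ k : OtherIndex hij, Function.update (Function.update
      (fun k => PMF.uniformOfFintype (A k)) i ((PMF.uniformOfFintype (Fin M × Bool)).map u)) j
      ((PMF.uniformOfFintype (Fin L × Bool)).map v) k.1.1 = PMF.uniformOfFintype (A k.1.1) := by
    intro k
    rw [Function.update_of_ne fun h => k.2 (Subtype.ext h), Function.update_of_ne k.1.2]
  rw [prod_splitPair hij, Function.update_self, Function.update_of_ne hij.symm,
    Function.update_self]
  simp only [hother, PMF.uniformOfFintype_apply]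
  by_cases hu : x i ∈ Set.range u
  swap
  · rw [map_apply_of_notMem_range _ hu, zero_mul, map_apply_of_notMem_range]
    rintro ⟨c, rfl⟩
    exact hu ⟨(c.1.1, c.2.1), by rw [gridPoint, splitPair_symm_apply_left]⟩
  by_cases hv : x j ∈ Set.range v
  swap
  · rw [map_apply_of_notMem_range _ hv, zero_mul, mul_zero, map_apply_of_notMem_range]
    rintro ⟨c, rfl⟩
    exact hv ⟨(c.1.2.1, c.2.2), by rw [gridPoint, splitPair_symm_apply_right]⟩
  obtain ⟨c, hc⟩ := mem_range_gridPoint hij u v hu hv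
  obtain ⟨a, ha⟩ := hu
  obtain ⟨b, hb⟩ := hv
  rw [← hc, map_apply_of_injective _ (gridPoint_injective hij u v), hD, hc, ← ha, ← hb,
    map_apply_of_injective _ u.injective, map_apply_of_injective _ v.injective,
    PMF.uniformOfFintype_apply, PMF.uniformOfFintype_apply,
    ← ENNReal.prod_inv_distrib fun _ _ _ _ _ => Or.inr (ENNReal.natCast_ne_top _),
    ← ENNReal.mul_inv (Or.inr (ENNReal.prod_ne_top fun _ _ => ENNReal.natCast_ne_top _))
      (Or.inl (ENNReal.natCast_ne_top _)),
    ← ENNReal.mul_inv (Or.inr (ENNReal.mul_ne_top (ENNReal.natCast_ne_top _)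
      (ENNReal.prod_ne_top fun _ _ => ENNReal.natCast_ne_top _)))
      (Or.inl (ENNReal.natCast_ne_top _))]
  congr 1
  simp only [Fintype.card_prod, Fintype.card_fin, Fintype.card_bool, Fintype.card_pi]
  push_cast
  ring

/-- The sample bound in terms of `∏ k, |A k|`. -/
theorem card_le_mul_samples (hij : j ≠ i) (hi : 2 ≤ Fintype.card (A i))
    (hj : 2 ≤ Fintype.card (A j)) {σ : ℝ} (hσ0 : 0 < σ) (hσ1 : σ ≤ 1 / 4) {s : ℕ}
    (S : ProofSystem (∀ k, A k) s) (hc : Complete S) (hs : Sound σ S) :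
    ((∏ k, Fintype.card (A k) : ℕ) : ℝ) ≤ 2880 * (s ^ 2 * σ ^ 4) := by
  obtain ⟨M, hM⟩ : ∃ M, M = Fintype.card (A i) / 2 := ⟨_, rfl⟩
  obtain ⟨L, hL⟩ : ∃ L, L = Fintype.card (A j) / 2 := ⟨_, rfl⟩
  have : NeZero M := ⟨by omega⟩
  have : NeZero L := ⟨by omega⟩
  obtain ⟨u⟩ : Nonempty (Fin M × Bool ↪ A i) :=
    Function.Embedding.nonempty_of_card_le (by simp; omega)
  obtain ⟨v⟩ : Nonempty (Fin L × Bool ↪ A j) :=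
    Function.Embedding.nonempty_of_card_le (by simp; omega)
  have hmain := card_blocks_le (gridPoint_injective hij u v)
    (fun Q hQ b => hQ.gridPoint_rank_one hij u v b)
    (isProductDist_map_gridPoint hij u v) hσ0 hσ1 S hc hs
  -- Pairing may leave one value over, but `m ≤ 3 * (m / 2)` for `m ≥ 2`, which costs a factor `3`
  -- in each of two coordinates. Then `2880 = 9 * (5 / 4) * 4 ^ 4`.
  have hcard : ∏ k, Fintype.card (A k)
      ≤ 9 * Fintype.card (Fin M × Fin L × (∀ k : OtherIndex hij, A k.1.1)) := by
    rw [prod_splitPair hij, Fintype.card_prod, Fintype.card_prod, Fintype.card_fin,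
      Fintype.card_fin, Fintype.card_pi]
    calc _ ≤ 3 * M * (3 * L * ∏ k : OtherIndex hij, Fintype.card (A k.1.1)) := by
          gcongr <;> omega
      _ = _ := by ring
  have hcard' : ((∏ k, Fintype.card (A k) : ℕ) : ℝ)
      ≤ 9 * (Fintype.card (Fin M × Fin L × (∀ k : OtherIndex hij, A k.1.1)) : ℝ) := by
    exact_mod_cast hcard
  nlinarith

end Grid

end IndepProof

/-! ### The lower bound -/

theorem mainTheorem8 :
    ∃ c : ℝ, 0 < c ∧ ∃ k : ℕ,
      ∀ (n : ℕ) (A : Fin n → Type*) [∀ i, Fintype (A i)],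
        (∃ i j, i ≠ j ∧ 2 ≤ Fintype.card (A i) ∧ 2 ≤ Fintype.card (A j)) →
      ∀ (N : ℕ), N = ∏ i, Fintype.card (A i) →
      ∀ σ : ℝ, 0 < σ → σ ≤ 1 / 4 →
      ∀ (s : ℕ) (S : IndepProof.ProofSystem (∀ i, A i) s),
        IndepProof.Complete S → IndepProof.Sound σ S →
          c * (Real.sqrt N / σ ^ 2) / Real.log N ^ k ≤ (s : ℝ) := by
  -- Any constant up to `1 / √2880` would do, and no logarithm is needed.
  refine ⟨1 / 100, by norm_num, 0, ?_⟩
  rintro n A _ ⟨i, j, hij, hi, hj⟩ N rfl σ hσ0 hσ1 s S hc hs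
  rw [pow_zero, div_one]
  by_cases hne : ∀ k, Nonempty (A k)
  · have h := IndepProof.card_le_mul_samples hij.symm hi hj hσ0 hσ1 S hc hs
    have hsqrt : Real.sqrt (∏ k, Fintype.card (A k) : ℕ) ≤ 100 * (s * σ ^ 2) := by
      refine Real.sqrt_le_iff.2 ⟨by positivity, h.trans ?_⟩
      have : 0 ≤ (s : ℝ) ^ 2 * σ ^ 4 := by positivity
      nlinarith
    have hσ2 : 0 < σ ^ 2 := by positivity
    have : Real.sqrt (∏ k, Fintype.card (A k) : ℕ) / σ ^ 2 ≤ 100 * s := by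
      rw [div_le_iff₀ hσ2]; linarith
    linarith
  -- An empty factor makes `N = 0`, so the bound is trivial.
  · push Not at hne
    obtain ⟨k, hk⟩ := hne
    rw [Finset.prod_eq_zero (Finset.mem_univ k) Fintype.card_eq_zero]
    simp
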